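/- Let $P$ and $Q$ be finite posets and let $\mathbb{K}$ be a field. For an order-preserving map $\phi\colon P\to Q$ put $u_\phi=\prod_{p\in P}x_{p,\phi(p)}$, and let $L(P,Q)$ be the ideal generated by all monomials $u_\phi$, $\phi\colon P\to Q$ order-preserving, in the polynomial ring $S_{P,Q}=\mathbb{K}[x_{p,q} : p\in P,\ q\in Q]$. A poset is called rooted if no element is strictly larger than each of two incomparable elements, and co-rooted if no element is strictly smaller than each of two incomparable elements. It is called connected if its Hasse diagram is a connected (in particular non-empty) graph, and a disjoint union of chains if it can be partitioned into chains such that elements of different parts are incomparable. An ideal $I$ of a polynomial ring $S$ is unmixed if all associated primes of $I$ (that is, of the $S$-module $S/I$) have the same height. For a squarefree monomial ideal $I$ in the variables $x_v$, $v\in V$, with $V$ finite, put $x_F=\prod_{v\in F}x_v$ for $F\subseteq V$, let $\Delta=\{F\subseteq V : x_F\notin I\}$ be its Stanley–Reisner complex and $\Delta^\vee=\{F\subseteq V : V\setminus F\notin\Delta\}$ the Alexander dual complex; the Alexander dual $I^\vee$ of $I$ is the Stanley–Reisner ideal of $\Delta^\vee$, i.e. the ideal generated by all $x_F$ with $F\notin\Delta^\vee$.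 Finally, $L(Q,P)^\tau\subseteq S_{P,Q}$ denotes the image of $L(Q,P)\subseteq S_{Q,P}$ under the isomorphism $S_{Q,P}\to S_{P,Q}$, $x_{q,p}\mapsto x_{p,q}$. Then $L(P,Q)$ is unmixed if and only if one of the following conditions holds: (a) $P$ and $Q$ are both rooted; (b) $P$ and $Q$ are both co-rooted; (c) $P$ or $Q$ is a disjoint union of chains. Moreover, if $P$ or $Q$ is connected and $L(P,Q)$ is unmixed, then $L(P,Q)^\vee=L(Q,P)^\tau$. -/

import Mathlib

namespace PosetHomIdeal

section Posets

/-- A poset is rooted if no element lies strictly above two incomparable elements. -/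
def IsRooted (P : Type*) [PartialOrder P] : Prop :=
  ∀ p₁ p₂ : P, IncompRel (· ≤ ·) p₁ p₂ → ¬ ∃ p : P, p₁ < p ∧ p₂ < p

/-- A poset is co-rooted if no element lies strictly below two incomparable elements. -/
def IsCorooted (P : Type*) [PartialOrder P] : Prop :=
  ∀ p₁ p₂ : P, IncompRel (· ≤ ·) p₁ p₂ → ¬ ∃ p : P, p < p₁ ∧ p < p₂

/-- A poset is connected if its Hasse diagram is connected as a graph
(in particular it is non-empty). -/
def IsConnected (P : Type*) [PartialOrder P] : Prop :=
  (SimpleGraph.hasse P).Connected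

/-- A poset is a disjoint union of chains if it can be partitioned into chains such that
elements of different blocks are never comparable. -/
def IsDisjointUnionOfChains (P : Type*) [PartialOrder P] : Prop :=
  ∃ C : Set (Set P), Setoid.IsPartition C ∧ (∀ A ∈ C, IsChain (· ≤ ·) A) ∧
    C.Pairwise fun A B => ∀ a ∈ A, ∀ b ∈ B, ¬ a ≤ b

end Posets

section Ideals

/-- An ideal `I` of `S` is unmixed if all associated primes of `I`, that is, of the module
`S ⧸ I`, have the same height. -/
def IsUnmixed {S : Type*} [CommRing S] (I : Ideal S) : Prop :=
  ∀ 𝔭 ∈ associatedPrimes S (S ⧸ I), ∀ 𝔮 ∈ associatedPrimes S (S ⧸ I), 𝔭.height = 𝔮.height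

variable (K : Type*) [Field K]

/-- The squarefree monomial `x_F`, the product of the variables `x_i` with `i ∈ F`. -/
noncomputable def squarefreeMonomial {V : Type*} (F : Finset V) : MvPolynomial V K :=
  ∏ i ∈ F, MvPolynomial.X i

variable {K}

/-- The Stanley-Reisner complex of an ideal `I`: its faces are the sets `F` with `x_F ∉ I`.
Simplicial complexes on `V` are lower sets of finite subsets of `V`; the complex without any face
and the complex whose only face is `∅` are both allowed, and they are different. -/
def stanleyReisnerComplex {V : Type*} (I : Ideal (MvPolynomial V K)) : LowerSet (Finset V) where
  carrier := {F | squarefreeMonomial K F ∉ I}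
  lower' := fun _ _ hGF hF hG =>
    hF (I.mem_of_dvd (Finset.prod_dvd_prod_of_subset _ _ _ hGF) hG)

variable (K)

/-- The Stanley-Reisner ideal of a simplicial complex, generated by the `x_F` for the
non-faces `F`. -/
noncomputable def stanleyReisnerIdeal {V : Type*} (Δ : LowerSet (Finset V)) :
    Ideal (MvPolynomial V K) :=
  Ideal.span (squarefreeMonomial K '' {F | F ∉ Δ})

/-- The Alexander dual of a simplicial complex: its faces are the complements of the
non-faces. -/
def dualComplex {V : Type*} [Fintype V] [DecidableEq V] (Δ : LowerSet (Finset V)) :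
    LowerSet (Finset V) where
  carrier := {F | Fᶜ ∉ Δ}
  lower' := fun _ _ hGF hF hG => hF (Δ.lower (Finset.compl_subset_compl.2 hGF) hG)

variable {K}

/-- The Alexander dual `I^∨` of a squarefree monomial ideal `I`: the Stanley-Reisner ideal of the
Alexander dual of the Stanley-Reisner complex of `I`. -/
noncomputable def alexanderDual {V : Type*} [Fintype V] [DecidableEq V]
    (I : Ideal (MvPolynomial V K)) : Ideal (MvPolynomial V K) :=
  stanleyReisnerIdeal K (dualComplex (stanleyReisnerComplex I))

variable (K)

/-- The ideal `L(P,Q)` of `K[x_{p,q} : p ∈ P, q ∈ Q]`, generated by the monomials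
`u_φ = ∏ p, x_{p,φ(p)}` for all order-preserving maps `φ : P → Q`. -/
noncomputable def L (P Q : Type*) [PartialOrder P] [Fintype P] [PartialOrder Q] :
    Ideal (MvPolynomial (P × Q) K) :=
  Ideal.span (Set.range fun φ : P →o Q => ∏ p : P, MvPolynomial.X (p, φ p))

variable {K}

/-- `I^τ` is obtained from `I` by switching the indices of the variables, `x_{q,p} ↦ x_{p,q}`. -/
noncomputable def switchIndices {Q P : Type*} (I : Ideal (MvPolynomial (Q × P) K)) :
    Ideal (MvPolynomial (P × Q) K) :=
  I.map (MvPolynomial.rename (R := K) (Prod.swap : Q × P → P × Q))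

end Ideals

end PosetHomIdeal

/-! The associated primes of a squarefree monomial ideal are generated by the minimal transversals
of its generators, so unmixedness says that all minimal covers, the minimal sets meeting the graph
of every isotone `P → Q`, have the same size. Constant maps force a cover to meet each fibre `P ×
{y}`, and `{p} × Q` is a cover, so that size can only be `|Q|` when `P` is non-empty.

If the pair is compatible, two facts identify the minimal covers as the transposed graphs of isotone
`ψ : Q → P` with image in one component of `P`. First, a dichotomy
(`IsCompatiblePair.exists_monotone_or`): a relation contains the graph of an isotone `φ`, or its
complement contains such a transposed graph. Applied to the complement of a cover, it yields a `ψ`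
inside the cover. Second, a fixed point theorem (`IsCompatiblePair.exists_apply_apply_eq`): `ψ ∘ φ`
fixes a point, so the transposed graph meets every graph.

Conversely, if `P` is not rooted and `Q` not co-rooted, or dually, an explicit cover has only
minimal subcovers with two points in one fibre. Excluding both situations leaves the listed cases,
because a poset both rooted and co-rooted is a disjoint union of chains.

The Alexander dual is generated by the monomials of covers. Connectedness of `P` or `Q` puts the
image of every isotone `ψ` into one component. -/

namespace PosetHomIdeal

/-! ### Associated primes and Alexander duals via transversals -/

section Transversals

variable {K : Type*} [Field K] {V ι : Type*}

/-- The prime ideal generated by the variables indexed by `C`. -/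
noncomputable def variableIdeal (K : Type*) [Field K] {V : Type*} (C : Finset V) :
    Ideal (MvPolynomial V K) :=
  Ideal.span (MvPolynomial.X '' (C : Set V))

theorem mem_variableIdeal {C : Finset V} {f : MvPolynomial V K} :
    f ∈ variableIdeal K C ↔ ∀ m ∈ f.support, ∃ i ∈ C, m i ≠ 0 := by
  exact MvPolynomial.mem_ideal_span_X_image

theorem X_mem_variableIdeal {C : Finset V} {i : V} :
    MvPolynomial.X i ∈ variableIdeal K C ↔ i ∈ C := by
  classical
  rw [mem_variableIdeal]
  simp [MvPolynomial.support_X, Finsupp.single_apply]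

/-- Setting the variables in `C` to zero changes a polynomial only by an element of the ideal, so
the ideal is the kernel of an endomorphism of a domain. -/
theorem variableIdeal_isPrime (C : Finset V) : (variableIdeal K C).IsPrime := by
  classical
  let g : MvPolynomial V K →ₐ[K] MvPolynomial V K :=
    MvPolynomial.aeval fun i => if i ∈ C then 0 else MvPolynomial.X i
  have hsub : ∀ f, f - g f ∈ variableIdeal K C := by
    intro f
    induction f using MvPolynomial.induction_on with
    | C a => simp [g]
    | add p q hp hq =>
      have := add_mem hp hq
      rw [map_add]
      convert this using 1
      ring
    | mul_X p i hp =>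
      have hX : MvPolynomial.X i - g (MvPolynomial.X i) ∈ variableIdeal K C := by
        by_cases hi : i ∈ C
        · simpa [g, hi] using X_mem_variableIdeal.2 hi
        · simp [g, hi]
      have := add_mem (Ideal.mul_mem_right (MvPolynomial.X i) _ hp)
        (Ideal.mul_mem_left _ (g p) hX)
      rw [map_mul]
      convert this using 1
      ring
  have hker : variableIdeal K C = RingHom.ker g := by
    refine le_antisymm (Ideal.span_le.2 ?_) fun f hf => ?_
    · rintro _ ⟨i, hi, rfl⟩
      have hi' : i ∈ C := hi
      simp [g, RingHom.mem_ker, hi']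
    · have := hsub f
      rwa [RingHom.mem_ker.1 hf, sub_zero] at this
  rw [hker]
  exact RingHom.ker_isPrime _

theorem variableIdeal_le_iff {C D : Finset V} :
    variableIdeal K C ≤ variableIdeal K D ↔ C ⊆ D := by
  refine ⟨fun h i hi => X_mem_variableIdeal.1 (h (X_mem_variableIdeal.2 hi)), fun h => ?_⟩
  exact Ideal.span_mono (Set.image_mono (by exact_mod_cast h))

/-- Krull's height theorem bounds the height above; adding the variables one at a time gives a chain
of primes that bounds it below. -/
theorem height_variableIdeal [Finite V] (C : Finset V) :
    (variableIdeal K C).height = C.card := by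
  classical
  have hprime : ∀ D : Finset V, (variableIdeal K D).IsPrime := variableIdeal_isPrime
  apply le_antisymm
  · have hmin : variableIdeal K C ∈
        (Ideal.span ((C.image MvPolynomial.X : Finset (MvPolynomial V K)) : Set _)).minimalPrimes := by
      rw [Finset.coe_image, ← variableIdeal]
      have := hprime C
      rw [Ideal.minimalPrimes_eq_subsingleton_self]
      rfl
    refine (Ideal.height_le_card_of_mem_minimalPrimes_span_finset hmin).trans ?_
    exact_mod_cast Finset.card_image_le
  · induction C using Finset.induction_on with
    | empty => simp
    | insert a C ha ih =>
      have := hprime C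
      have := hprime (insert a C)
      have hlt : variableIdeal K C < variableIdeal K (insert a C) :=
        lt_of_le_not_ge (variableIdeal_le_iff.2 (Finset.subset_insert _ _)) fun h =>
          ha (variableIdeal_le_iff.1 h (Finset.mem_insert_self _ _))
      rw [Finset.card_insert_of_notMem ha, Nat.cast_add, Nat.cast_one]
      exact (add_le_add_left ih 1).trans (Ideal.height_add_one_le_of_lt_of_isPrime hlt)

/-- The ideal generated by the squarefree monomials `x_F` with `F` in a family of sets. -/
noncomputable def edgeIdeal (K : Type*) [Field K] {V ι : Type*} (E : ι → Finset V) :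
    Ideal (MvPolynomial V K) :=
  Ideal.span (Set.range fun i => squarefreeMonomial K (E i))

/-- `C` is a transversal (or vertex cover) of the family `E` if it meets every member of `E`. -/
def IsTransversal (E : ι → Finset V) (C : Finset V) : Prop :=
  ∀ i, ∃ v ∈ E i, v ∈ C

theorem squarefreeMonomial_eq_monomial (F : Finset V) :
    squarefreeMonomial K F = MvPolynomial.monomial (∑ v ∈ F, Finsupp.single v 1) 1 := by
  rw [squarefreeMonomial, MvPolynomial.monomial_sum_one]
  rfl

theorem sum_single_apply [DecidableEq V] (F : Finset V) (v : V) :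
    (∑ w ∈ F, Finsupp.single w 1 : V →₀ ℕ) v = if v ∈ F then 1 else 0 := by
  simp [Finsupp.finsetSum_apply, Finsupp.single_apply]

theorem mem_edgeIdeal {E : ι → Finset V} {f : MvPolynomial V K} :
    f ∈ edgeIdeal K E ↔ ∀ m ∈ f.support, ∃ i, E i ⊆ m.support := by
  classical
  have h : edgeIdeal K E = Ideal.span ((fun s => MvPolynomial.monomial s (1 : K)) ''
      Set.range fun i => ∑ v ∈ E i, Finsupp.single v 1) := by
    rw [edgeIdeal, ← Set.range_comp]
    simp only [squarefreeMonomial_eq_monomial, Function.comp_def]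
  rw [h, MvPolynomial.mem_ideal_span_monomial_image]
  simp only [Set.exists_range_iff]
  refine forall₂_congr fun m _ => exists_congr fun i => ?_
  constructor
  · intro hle v hv
    have := hle v
    rw [sum_single_apply, if_pos hv] at this
    exact Finsupp.mem_support_iff.2 (by omega)
  · intro hsub v
    rw [sum_single_apply]
    split_ifs with hv
    · exact Nat.one_le_iff_ne_zero.2 (Finsupp.mem_support_iff.1 (hsub hv))
    · exact Nat.zero_le _

theorem squarefreeMonomial_mem_edgeIdeal {E : ι → Finset V} {F : Finset V} :
    squarefreeMonomial K F ∈ edgeIdeal K E ↔ ∃ i, E i ⊆ F := by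
  classical
  have hsupp : (∑ v ∈ F, Finsupp.single v 1 : V →₀ ℕ).support = F := by
    ext v
    rw [Finsupp.mem_support_iff, sum_single_apply]
    simp
  rw [mem_edgeIdeal, squarefreeMonomial_eq_monomial, MvPolynomial.support_monomial,
    if_neg one_ne_zero]
  simp only [Finset.mem_singleton, forall_eq, hsupp]

theorem edgeIdeal_le_variableIdeal {E : ι → Finset V} {C : Finset V} (hC : IsTransversal E C) :
    edgeIdeal K E ≤ variableIdeal K C := by
  intro f hf
  rw [mem_variableIdeal]
  intro m hm
  obtain ⟨i, hi⟩ := mem_edgeIdeal.1 hf m hm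
  obtain ⟨v, hv, hvC⟩ := hC i
  exact ⟨v, hvC, Finsupp.mem_support_iff.1 (hi hv)⟩

theorem squarefreeMonomial_compl_notMem_variableIdeal [Fintype V] [DecidableEq V]
    (C : Finset V) : squarefreeMonomial K Cᶜ ∉ variableIdeal K C := by
  intro h
  have := variableIdeal_isPrime (K := K) C
  obtain ⟨i, hi, hiC⟩ := (Ideal.IsPrime.prod_mem_iff (p := variableIdeal K C)).1 h
  exact Finset.mem_compl.1 hi (X_mem_variableIdeal.1 hiC)

theorem exists_minimal_transversal_le [Finite V] {E : ι → Finset V} {C : Finset V}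
    (hC : IsTransversal E C) : ∃ D ⊆ C, Minimal (IsTransversal E) D := by
  obtain ⟨D, hDC, hD⟩ := exists_minimal_le_of_wellFoundedLT (IsTransversal E) C hC
  exact ⟨D, hDC, hD⟩

/-- If the support of a monomial contains no edge, its complement is a transversal, and the prime of
a minimal transversal inside it misses the monomial. -/
theorem mem_edgeIdeal_of_forall_mem_variableIdeal [Finite V] {E : ι → Finset V}
    {f : MvPolynomial V K} (hf : ∀ C, Minimal (IsTransversal E) C → f ∈ variableIdeal K C) :
    f ∈ edgeIdeal K E := by
  classical
  have := Fintype.ofFinite V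
  rw [mem_edgeIdeal]
  intro m hm
  by_contra! hE
  have hT : IsTransversal E m.supportᶜ := fun i => by
    obtain ⟨v, hv, hvm⟩ := Finset.not_subset.1 (hE i)
    exact ⟨v, hv, Finset.mem_compl.2 hvm⟩
  obtain ⟨D, hD, hmin⟩ := exists_minimal_transversal_le hT
  obtain ⟨v, hv, hvm⟩ := mem_variableIdeal.1 (hf D hmin) m hm
  exact Finset.mem_compl.1 (hD hv) (Finsupp.mem_support_iff.2 hvm)

theorem mem_colon_mk_iff {R : Type*} [CommRing R] {I : Ideal R} {f g : R} :
    g ∈ (⊥ : Submodule R (R ⧸ I)).colon {Ideal.Quotient.mk I f} ↔ g * f ∈ I := by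
  rw [Submodule.mem_colon_singleton, Submodule.mem_bot, Algebra.smul_def,
    Ideal.Quotient.algebraMap_eq, ← map_mul, Ideal.Quotient.eq_zero_iff_mem]

/-- The associated primes of a squarefree monomial ideal are generated by the minimal
transversals of its generators. -/
theorem mem_associatedPrimes_edgeIdeal [Finite V] {E : ι → Finset V}
    {𝔭 : Ideal (MvPolynomial V K)} :
    𝔭 ∈ associatedPrimes (MvPolynomial V K) (MvPolynomial V K ⧸ edgeIdeal K E) ↔
      ∃ C, Minimal (IsTransversal E) C ∧ variableIdeal K C = 𝔭 := by
  classical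
  have := Fintype.ofFinite V
  rw [AssociatedPrimes.mem_iff, isAssociatedPrime_iff]
  constructor
  · rintro ⟨hp, x, rfl⟩
    obtain ⟨f, rfl⟩ := Ideal.Quotient.mk_surjective x
    -- The annihilator of `f` contains the finite intersection of the primes avoiding `f`; being
    -- prime, it contains one of them.
    let T : Finset (Finset V) :=
      {C | Minimal (IsTransversal E) C ∧ f ∉ variableIdeal K C}
    have hle : T.inf (variableIdeal K) ≤
        (⊥ : Submodule (MvPolynomial V K) (MvPolynomial V K ⧸ edgeIdeal K E)).colon
          {Ideal.Quotient.mk _ f} := by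
      intro g hg
      rw [mem_colon_mk_iff]
      refine mem_edgeIdeal_of_forall_mem_variableIdeal fun C hC => ?_
      by_cases hfC : f ∈ variableIdeal K C
      · exact Ideal.mul_mem_left _ _ hfC
      · have hCT : C ∈ T := by simp [T, hC, hfC]
        exact Ideal.mul_mem_right _ _ (Finset.inf_le (f := variableIdeal K) hCT hg)
    obtain ⟨C, hCT, hC⟩ := hp.inf_le'.1 hle
    obtain ⟨hmin, hfC⟩ : Minimal (IsTransversal E) C ∧ f ∉ variableIdeal K C := by
      simpa [T] using hCT
    refine ⟨C, hmin, le_antisymm hC fun g hg => ?_⟩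
    rw [mem_colon_mk_iff] at hg
    exact ((variableIdeal_isPrime C).mem_or_mem
      (edgeIdeal_le_variableIdeal hmin.prop hg)).resolve_right hfC
  · rintro ⟨C, hmin, rfl⟩
    refine ⟨variableIdeal_isPrime C, Ideal.Quotient.mk _ (squarefreeMonomial K Cᶜ), ?_⟩
    refine le_antisymm (Ideal.span_le.2 ?_) fun g hg => ?_
    · rintro _ ⟨v, hv, rfl⟩
      have hv : v ∈ C := hv
      rw [SetLike.mem_coe, mem_colon_mk_iff]
      have hprod : MvPolynomial.X v * squarefreeMonomial K Cᶜ =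
          squarefreeMonomial K (insert v Cᶜ) := by
        rw [squarefreeMonomial, squarefreeMonomial, Finset.prod_insert (by simpa using hv)]
      rw [hprod, squarefreeMonomial_mem_edgeIdeal]
      -- By minimality some edge meets `C` at most in `v`, hence lies in `insert v Cᶜ`.
      have hnot : ¬ IsTransversal E (C.erase v) := fun h =>
        (Finset.erase_ssubset hv).not_subset (hmin.le_of_le h (Finset.erase_subset _ _))
      simp only [IsTransversal, not_forall, not_exists, not_and] at hnot
      obtain ⟨i, hi⟩ := hnot
      refine ⟨i, fun w hw => ?_⟩
      have := hi w hw
      rw [Finset.mem_erase, not_and_or, not_not] at this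
      simpa using this
    · rw [mem_colon_mk_iff] at hg
      exact ((variableIdeal_isPrime C).mem_or_mem
        (edgeIdeal_le_variableIdeal hmin.prop hg)).resolve_right
        (squarefreeMonomial_compl_notMem_variableIdeal C)

theorem isUnmixed_edgeIdeal_iff [Finite V] {E : ι → Finset V} :
    IsUnmixed (edgeIdeal K E) ↔ ∀ C D, Minimal (IsTransversal E) C →
      Minimal (IsTransversal E) D → C.card = D.card := by
  have hcard : ∀ C D : Finset V,
      (variableIdeal K C).height = (variableIdeal K D).height ↔ C.card = D.card := by
    intro C D
    rw [height_variableIdeal, height_variableIdeal, Nat.cast_inj]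
  constructor
  · intro h C D hC hD
    exact (hcard C D).1 (h _ (mem_associatedPrimes_edgeIdeal.2 ⟨C, hC, rfl⟩) _
      (mem_associatedPrimes_edgeIdeal.2 ⟨D, hD, rfl⟩))
  · intro h 𝔭 h𝔭 𝔮 h𝔮
    obtain ⟨C, hC, rfl⟩ := mem_associatedPrimes_edgeIdeal.1 h𝔭
    obtain ⟨D, hD, rfl⟩ := mem_associatedPrimes_edgeIdeal.1 h𝔮
    exact (hcard C D).2 (h C D hC hD)

theorem alexanderDual_edgeIdeal [Fintype V] [DecidableEq V] (E : ι → Finset V) :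
    alexanderDual (edgeIdeal K E) =
      Ideal.span (squarefreeMonomial K '' {F | IsTransversal E F}) := by
  have h : ∀ F : Finset V,
      F ∉ dualComplex (stanleyReisnerComplex (edgeIdeal K E)) ↔ IsTransversal E F := by
    intro F
    change ¬ ¬ ¬ (squarefreeMonomial K Fᶜ ∈ edgeIdeal K E) ↔ _
    rw [not_not, squarefreeMonomial_mem_edgeIdeal, not_exists]
    refine forall_congr' fun i => ?_
    simp [Finset.not_subset]
  simp only [alexanderDual, stanleyReisnerIdeal, h]

end Transversals

/-! ### The dichotomy for rooted pairs and for chains -/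

section Gluing

variable {P Q ι : Type*} [PartialOrder P] [PartialOrder Q]

/-- Monotone choice functions on the blocks of a decomposition of `U`, where comparable elements
lie in the same block, glue to a monotone choice function on `U`. -/
theorem exists_monotoneOn_of_blocks {U : Set P} {G : P → Q → Prop} (r : P → ι)
    (hr : ∀ x ∈ U, ∀ y ∈ U, x ≤ y → r x = r y)
    (h : ∀ i, ∃ φ : P → Q, MonotoneOn φ {x ∈ U | r x = i} ∧ ∀ x ∈ U, r x = i → G x (φ x)) :
    ∃ φ : P → Q, MonotoneOn φ U ∧ ∀ x ∈ U, G x (φ x) := by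
  choose φ hφ hG using h
  refine ⟨fun x => φ (r x) x, fun x hx y hy hxy => ?_, fun x hx => hG _ x hx rfl⟩
  have hxy' := hr x hx y hy hxy
  change φ (r x) x ≤ φ (r y) y
  rw [← hxy']
  exact hφ _ ⟨hx, rfl⟩ ⟨hy, hxy'.symm⟩ hxy

theorem IsRooted.le_or_le (hP : IsRooted P) {a b c : P} (ha : a ≤ c) (hb : b ≤ c) :
    a ≤ b ∨ b ≤ a := by
  by_contra! h
  refine hP a b h ⟨c, lt_of_le_of_ne ha ?_, lt_of_le_of_ne hb ?_⟩
  · rintro rfl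
    exact h.2 hb
  · rintro rfl
    exact h.1 ha

/-- In a rooted poset, monotone choice functions on principal upper sets glue to one on any
set. -/
theorem IsRooted.exists_monotoneOn [Finite P] (hP : IsRooted P) (U : Set P)
    {G : P → Q → Prop}
    (h : ∀ p, ∃ φ : P → Q, p ∈ U → MonotoneOn φ (Set.Ici p) ∧ ∀ x, p ≤ x → G x (φ x)) :
    ∃ φ : P → Q, MonotoneOn φ U ∧ ∀ x ∈ U, G x (φ x) := by
  -- Blocks are labelled by a minimal element of `U` below `x`. Lower sets are chains, so comparable
  -- elements share it; the label outside `U` is arbitrary.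
  have hroot : ∀ x, ∃ m, x ∈ U → m ≤ x ∧ Minimal (· ∈ U) m := by
    intro x
    by_cases hx : x ∈ U
    · obtain ⟨m, hm⟩ := exists_minimal_le_of_wellFoundedLT (· ∈ U) x hx
      exact ⟨m, fun _ => hm⟩
    · exact ⟨x, fun h => absurd h hx⟩
  choose r hr using hroot
  refine exists_monotoneOn_of_blocks r (fun x hx y hy hxy => ?_) fun p => ?_
  · obtain ⟨hx1, hx2⟩ := hr x hx
    obtain ⟨hy1, hy2⟩ := hr y hy
    rcases hP.le_or_le (hx1.trans hxy) hy1 with h1 | h1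
    · exact hy2.eq_of_le hx2.prop h1
    · exact (hx2.eq_of_le hy2.prop h1).symm
  · obtain ⟨φ, hφ⟩ := h p
    have hmem : ∀ x ∈ U, r x = p → p ∈ U ∧ p ≤ x := by
      rintro x hx rfl
      exact ⟨(hr x hx).2.prop, (hr x hx).1⟩
    refine ⟨φ, fun x hx y hy hxy => ?_, fun x hx hxp => ?_⟩
    · obtain ⟨hp, hpx⟩ := hmem x hx.1 hx.2
      exact (hφ hp).1 hpx (hpx.trans hxy) hxy
    · obtain ⟨hp, hpx⟩ := hmem x hx hxp
      exact (hφ hp).2 x hpx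

/-- The branches above `p` glue, and their common lower bound `q` makes `q` an admissible value at
`p`. -/
theorem IsRooted.exists_monotoneOn_Ici [Finite P] (hP : IsRooted P) {G : P → Q → Prop}
    {p : P} {q : Q} (hG : G p q)
    (h : ∀ p', p < p' → ∃ φ : P → Q, MonotoneOn φ (Set.Ici p') ∧
      ∀ x, p' ≤ x → q ≤ φ x ∧ G x (φ x)) :
    ∃ φ : P → Q, MonotoneOn φ (Set.Ici p) ∧ ∀ x, p ≤ x → q ≤ φ x ∧ G x (φ x) := by
  classical
  obtain ⟨φ, hφ, hφG⟩ := hP.exists_monotoneOn (Set.Ioi p)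
    (G := fun x y => q ≤ y ∧ G x y) fun p' => by
      by_cases hp' : p < p'
      · obtain ⟨φ, hφ⟩ := h p' hp'
        exact ⟨φ, fun _ => hφ⟩
      · exact ⟨fun _ => q, fun h => absurd h hp'⟩
  refine ⟨Function.update φ p q, fun x hx y hy hxy => ?_, fun x hx => ?_⟩
  · rcases eq_or_lt_of_le (Set.mem_Ici.1 hx) with rfl | hpx
    · rw [Function.update_self]
      rcases eq_or_lt_of_le (Set.mem_Ici.1 hy) with rfl | hpy
      · rw [Function.update_self]
      · rw [Function.update_of_ne hpy.ne']
        exact (hφG y hpy).1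
    · have hpy := hpx.trans_le hxy
      rw [Function.update_of_ne hpx.ne', Function.update_of_ne hpy.ne']
      exact hφ hpx hpy hxy
  · rcases eq_or_lt_of_le hx with rfl | hpx
    · rw [Function.update_self]
      exact ⟨le_rfl, hG⟩
    · rw [Function.update_of_ne hpx.ne']
      exact hφG x hpx

/-- Downward induction on `(p, q)`. If `F p q` holds, either every branch above `p` carries a
suitable `φ` and these extend by `p ↦ q`, or some `p' > p` carries none and the case `(p', q)`
supplies `ψ`. If `F p q` fails, the roles of `P` and `Q` are exchanged. -/
theorem IsRooted.exists_monotoneOn_Ici_or [Finite P] [Finite Q] (hP : IsRooted P)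
    (hQ : IsRooted Q) (F : P → Q → Prop) (z : P × Q) :
    (∃ φ : P → Q, MonotoneOn φ (Set.Ici z.1) ∧ ∀ x, z.1 ≤ x → z.2 ≤ φ x ∧ F x (φ x)) ∨
    ∃ ψ : Q → P, MonotoneOn ψ (Set.Ici z.2) ∧ ∀ y, z.2 ≤ y → z.1 ≤ ψ y ∧ ¬ F (ψ y) y := by
  induction z using WellFoundedGT.induction with
  | _ z ih =>
    obtain ⟨p, q⟩ := z
    by_cases hF : F p q
    · by_cases h : ∀ p', p < p' → ∃ φ : P → Q, MonotoneOn φ (Set.Ici p') ∧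
          ∀ x, p' ≤ x → q ≤ φ x ∧ F x (φ x)
      · exact Or.inl (hP.exists_monotoneOn_Ici hF h)
      · push Not at h
        obtain ⟨p', hpp', hno⟩ := h
        rcases ih (p', q) (Prod.mk_lt_mk_of_lt_of_le hpp' le_rfl) with ⟨φ, hφ, hφF⟩ | ⟨ψ, hψ, hψF⟩
        · obtain ⟨x, hx, hxF⟩ := hno φ hφ
          exact absurd (hφF x hx).2 (hxF (hφF x hx).1)
        · exact Or.inr ⟨ψ, hψ, fun y hy => ⟨hpp'.le.trans (hψF y hy).1, (hψF y hy).2⟩⟩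
    · by_cases h : ∀ q', q < q' → ∃ ψ : Q → P, MonotoneOn ψ (Set.Ici q') ∧
          ∀ y, q' ≤ y → p ≤ ψ y ∧ ¬ F (ψ y) y
      · exact Or.inr (hQ.exists_monotoneOn_Ici (G := fun y x => ¬ F x y) hF h)
      · push Not at h
        obtain ⟨q', hqq', hno⟩ := h
        rcases ih (p, q') (Prod.mk_lt_mk_of_le_of_lt le_rfl hqq') with ⟨φ, hφ, hφF⟩ | ⟨ψ, hψ, hψF⟩
        · exact Or.inl ⟨φ, hφ, fun x hx => ⟨hqq'.le.trans (hφF x hx).1, (hφF x hx).2⟩⟩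
        · obtain ⟨y, hy, hyF⟩ := hno ψ hψ
          exact absurd (hyF (hψF y hy).1) (hψF y hy).2

/-- For finite rooted posets, any relation contains the graph of an isotone map `P → Q`, or its
complement contains the transposed graph of an isotone map `Q → P`. -/
theorem IsRooted.exists_monotone_or [Finite P] [Finite Q] (hP : IsRooted P)
    (hQ : IsRooted Q) (F : P → Q → Prop) :
    (∃ φ : P → Q, Monotone φ ∧ ∀ x, F x (φ x)) ∨
    ∃ (p : P) (ψ : Q → P), Monotone ψ ∧ ∀ y, p ≤ ψ y ∧ ¬ F (ψ y) y := by
  by_cases h : ∀ p, ∃ φ : P → Q, MonotoneOn φ (Set.Ici p) ∧ ∀ x, p ≤ x → F x (φ x)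
  · obtain ⟨φ, hφ, hφF⟩ := hP.exists_monotoneOn Set.univ (G := F) fun p => by
      obtain ⟨φ, hφ⟩ := h p
      exact ⟨φ, fun _ => hφ⟩
    exact Or.inl ⟨φ, monotoneOn_univ.1 hφ, fun x => hφF x trivial⟩
  -- One bad `p` serves all `q` at once, so the local `ψ` glue with values above this single `p`.
  · push Not at h
    obtain ⟨p, hno⟩ := h
    obtain ⟨ψ, hψ, hψF⟩ := hQ.exists_monotoneOn Set.univ
      (G := fun y x => p ≤ x ∧ ¬ F x y) fun q => by
        rcases hP.exists_monotoneOn_Ici_or hQ F (p, q) with ⟨φ, hφ, hφF⟩ | ⟨ψ, hψ⟩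
        · obtain ⟨x, hx, hxF⟩ := hno φ hφ
          exact absurd (hφF x hx).2 hxF
        · exact ⟨ψ, fun _ => hψ⟩
    exact Or.inr ⟨p, ψ, monotoneOn_univ.1 hψ, fun y => hψF y trivial⟩

theorem IsCorooted.dual (hP : IsCorooted P) : IsRooted Pᵒᵈ := fun a b hab ⟨c, hac, hbc⟩ =>
  hP (OrderDual.ofDual a) (OrderDual.ofDual b) hab.symm ⟨OrderDual.ofDual c, hac, hbc⟩

theorem IsCorooted.exists_monotone_or [Finite P] [Finite Q] (hP : IsCorooted P)
    (hQ : IsCorooted Q) (F : P → Q → Prop) :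
    (∃ φ : P → Q, Monotone φ ∧ ∀ x, F x (φ x)) ∨
    ∃ (p : P) (ψ : Q → P), Monotone ψ ∧ ∀ y, ψ y ≤ p ∧ ¬ F (ψ y) y := by
  rcases hP.dual.exists_monotone_or hQ.dual (fun x y => F (OrderDual.ofDual x) (OrderDual.ofDual y))
    with ⟨φ, hφ, hφF⟩ | ⟨p, ψ, hψ, hψF⟩
  · exact Or.inl ⟨fun x => OrderDual.ofDual (φ (OrderDual.toDual x)), fun a b hab => hφ hab,
      fun x => hφF (OrderDual.toDual x)⟩
  · exact Or.inr ⟨OrderDual.ofDual p, fun y => OrderDual.ofDual (ψ (OrderDual.toDual y)),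
      fun a b hab => hψ hab, fun y => hψF (OrderDual.toDual y)⟩

/-- If `S` is a finite chain, then any relation contains the graph of an isotone map `S → T`, or its
complement contains the transposed graph of an isotone map `T → S`. -/
theorem exists_monotoneOn_or_of_isChain (F : P → Q → Prop) (S : Finset P)
    (hS : IsChain (· ≤ ·) (S : Set P)) {T : Set Q} (hT : T.Nonempty) :
    (∃ φ : P → Q, MonotoneOn φ S ∧ (∀ x ∈ S, φ x ∈ T ∧ F x (φ x)) ∧ ∃ t ∈ T, ∀ x ∈ S, t ≤ φ x) ∨
    ∃ ψ : Q → P, MonotoneOn ψ T ∧ ∀ y ∈ T, ψ y ∈ S ∧ ¬ F (ψ y) y := by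
  classical
  induction S using Finset.strongInduction generalizing T with
  | H S ih =>
    obtain ⟨t, ht⟩ := hT
    rcases S.eq_empty_or_nonempty with rfl | hne
    · exact Or.inl ⟨fun _ => t, monotoneOn_const, by simp, t, ht, by simp⟩
    obtain ⟨m, hm⟩ := S.exists_minimal hne
    have hmle : ∀ x ∈ S, m ≤ x := fun x hx =>
      (hS.total hm.prop hx).elim id fun h => hm.le_of_le hx h
    -- The part of `T` still open to the rest of `S` once `m` has received a value. It is an upper
    -- set in `T`, so a `ψ` on `T'` extends by the least element `m`; for `φ`, the lower bound in
    -- the conclusion provides the value at `m`.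
    let T' : Set Q := {y ∈ T | ∃ t ∈ T, F m t ∧ t ≤ y}
    rcases T'.eq_empty_or_nonempty with hT' | hT'
    · refine Or.inr ⟨fun _ => m, monotoneOn_const, fun y hy => ⟨hm.prop, fun hF => ?_⟩⟩
      have : y ∈ T' := ⟨hy, y, hy, hF, le_rfl⟩
      simp [hT'] at this
    rcases ih (S.erase m) (Finset.erase_ssubset hm.prop)
      (hS.mono (by exact_mod_cast S.erase_subset m)) hT' with
      ⟨φ, hφ, hφF, t', ⟨ht', s, hs, hFs, hst'⟩, hle⟩ | ⟨ψ, hψ, hψF⟩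
    · have hmem : ∀ x ∈ S, x ≠ m → x ∈ S.erase m := fun x hx h => Finset.mem_erase.2 ⟨h, hx⟩
      refine Or.inl ⟨Function.update φ m s, fun x hx y hy hxy => ?_, fun x hx => ?_, s, hs,
        fun x hx => ?_⟩
      · have hx : x ∈ S := hx
        have hy : y ∈ S := hy
        by_cases hxm : x = m
        · subst hxm
          by_cases hym : y = x
          · rw [hym]
          · rw [Function.update_self, Function.update_of_ne hym]
            exact hst'.trans (hle y (hmem y hy hym))
        · have hym : y ≠ m := by
            rintro rfl
            exact hxm (le_antisymm hxy (hmle x hx))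
          rw [Function.update_of_ne hxm, Function.update_of_ne hym]
          exact hφ (hmem x hx hxm) (hmem y hy hym) hxy
      · by_cases hxm : x = m
        · subst hxm
          rw [Function.update_self]
          exact ⟨hs, hFs⟩
        · rw [Function.update_of_ne hxm]
          exact ⟨(hφF x (hmem x hx hxm)).1.1, (hφF x (hmem x hx hxm)).2⟩
      · by_cases hxm : x = m
        · subst hxm
          rw [Function.update_self]
        · rw [Function.update_of_ne hxm]
          exact hst'.trans (hle x (hmem x hx hxm))
    · refine Or.inr ⟨fun y => if y ∈ T' then ψ y else m, fun x hx y hy hxy => ?_, fun y hy => ?_⟩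
      · by_cases hxT : x ∈ T'
        · have hyT : y ∈ T' := by
            obtain ⟨_, u, hu, hFu, hux⟩ := hxT
            exact ⟨hy, u, hu, hFu, hux.trans hxy⟩
          simp only [hxT, hyT, if_true]
          exact hψ hxT hyT hxy
        · simp only [hxT, if_false]
          split_ifs with hyT
          · exact hmle _ (Finset.mem_of_mem_erase (hψF y hyT).1)
          · exact le_rfl
      · by_cases hyT : y ∈ T'
        · simp only [hyT, if_true]
          exact ⟨Finset.mem_of_mem_erase (hψF y hyT).1, (hψF y hyT).2⟩
        · simp only [hyT, if_false]
          exact ⟨hm.prop, fun hF => hyT ⟨hy, y, hy, hF, le_rfl⟩⟩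

end Gluing

/-! ### Connected components and the dichotomy for disjoint unions of chains -/

section Components

variable {P Q : Type*} [PartialOrder P] [PartialOrder Q]

/-- Two elements are linked if they lie in the same connected component of the poset. -/
def Linked (a b : P) : Prop := Relation.EqvGen (· ≤ ·) a b

theorem linked_equivalence : Equivalence (Linked (P := P)) := Relation.EqvGen.is_equivalence _

theorem Linked.of_le {a b : P} (h : a ≤ b) : Linked a b := Relation.EqvGen.rel _ _ h

theorem Linked.symm {a b : P} (h : Linked a b) : Linked b a := linked_equivalence.symm h

theorem Linked.trans {a b c : P} (h : Linked a b) (h' : Linked b c) : Linked a c :=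
  linked_equivalence.trans h h'

theorem Linked.map {a b : P} (h : Linked a b) {φ : P → Q} (hφ : Monotone φ) :
    Linked (φ a) (φ b) := by
  induction h with
  | rel a b h => exact Linked.of_le (hφ h)
  | refl a => exact linked_equivalence.refl _
  | symm a b _ ih => exact ih.symm
  | trans a b c _ _ ih ih' => exact ih.trans ih'

theorem IsConnected.linked (hP : IsConnected P) (a b : P) : Linked a b := by
  obtain ⟨w⟩ := SimpleGraph.Connected.preconnected hP a b
  induction w with
  | nil => exact linked_equivalence.refl _
  | cons h _ ih =>
    refine Linked.trans ?_ ih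
    rcases h with h | h
    · exact Linked.of_le h.le
    · exact (Linked.of_le h.le).symm

theorem IsDisjointUnionOfChains.le_or_le (hP : IsDisjointUnionOfChains P) {a b : P}
    (h : Linked a b) : a ≤ b ∨ b ≤ a := by
  obtain ⟨C, hC, hchain, hpair⟩ := hP
  have hblock : ∀ A ∈ C, (a ∈ A ↔ b ∈ A) := by
    induction h with
    | rel a b h =>
      intro A hA
      obtain ⟨B, ⟨hB, haB⟩, haU⟩ := hC.2 a
      obtain ⟨D, ⟨hD, hbD⟩, hbU⟩ := hC.2 b
      have hBD : B = D := by
        by_contra hne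
        exact hpair hB hD hne a haB b hbD h
      subst hBD
      exact ⟨fun ha => haU A ⟨hA, ha⟩ ▸ hbD, fun hb => hbU A ⟨hA, hb⟩ ▸ haB⟩
    | refl a => exact fun _ _ => Iff.rfl
    | symm a b _ ih => exact fun A hA => (ih A hA).symm
    | trans a b c _ _ ih ih' => exact fun A hA => (ih A hA).trans (ih' A hA)
  obtain ⟨A, ⟨hA, haA⟩, -⟩ := hC.2 a
  exact (hchain A hA).total haA ((hblock A hA).1 haA)

/-- Comparability is transitive: rootedness handles a common upper bound, co-rootedness a common
lower bound. Its classes are the chains. -/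
theorem isDisjointUnionOfChains_of_isRooted_of_isCorooted (hP : IsRooted P)
    (hP' : IsCorooted P) : IsDisjointUnionOfChains P := by
  let s : Setoid P :=
    { r := fun a b => a ≤ b ∨ b ≤ a
      iseqv :=
        { refl := fun a => Or.inl le_rfl
          symm := fun h => h.symm
          trans := by
            rintro a b c (hab | hba) (hbc | hcb)
            · exact Or.inl (hab.trans hbc)
            · exact hP.le_or_le hab hcb
            · exact (hP'.dual.le_or_le (a := OrderDual.toDual a) (b := OrderDual.toDual c)
                (c := OrderDual.toDual b) hba hbc).symm
            · exact Or.inr (hcb.trans hba) } }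
  refine ⟨s.classes, s.isPartition_classes, ?_, ?_⟩
  · rintro _ ⟨c, rfl⟩ a ha b hb -
    exact s.trans' ha (s.symm' hb)
  · rintro _ ⟨c, rfl⟩ _ ⟨d, rfl⟩ hne a ha b hb hab
    have h : s c d := s.trans' (s.symm' ha) (s.trans' (Or.inl hab) hb)
    refine hne (Set.ext fun x => ⟨fun hx => s.trans' hx h, fun hx => s.trans' hx (s.symm' h)⟩)

theorem IsDisjointUnionOfChains.exists_monotoneOn_component_or [Finite P]
    (hP : IsDisjointUnionOfChains P) (F : P → Q → Prop) (p : P) (q : Q) :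
    (∃ φ : P → Q, MonotoneOn φ {x | Linked p x} ∧ ∀ x, Linked p x → Linked q (φ x) ∧ F x (φ x)) ∨
    ∃ ψ : Q → P, MonotoneOn ψ {y | Linked q y} ∧
      ∀ y, Linked q y → Linked p (ψ y) ∧ ¬ F (ψ y) y := by
  have hfin : {x | Linked p x}.Finite := Set.toFinite _
  have hchain : IsChain (· ≤ ·) (hfin.toFinset : Set P) := by
    rw [hfin.coe_toFinset]
    intro x hx y hy _
    exact hP.le_or_le (hx.symm.trans hy)
  rcases exists_monotoneOn_or_of_isChain F hfin.toFinset hchain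
    (T := {y | Linked q y}) ⟨q, linked_equivalence.refl q⟩ with ⟨φ, hφ, hφF, -⟩ | ⟨ψ, hψ, hψF⟩
  · rw [hfin.coe_toFinset] at hφ
    exact Or.inl ⟨φ, hφ, fun x hx => hφF x (hfin.mem_toFinset.2 hx)⟩
  · exact Or.inr ⟨ψ, hψ, fun y hy => ⟨hfin.mem_toFinset.1 (hψF y hy).1, (hψF y hy).2⟩⟩

theorem exists_monotone_of_components {G : P → Q → Prop}
    (h : ∀ p, ∃ φ : P → Q, MonotoneOn φ {x | Linked p x} ∧ ∀ x, Linked p x → G x (φ x)) :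
    ∃ φ : P → Q, Monotone φ ∧ ∀ x, G x (φ x) := by
  let s : Setoid P := ⟨Linked, linked_equivalence⟩
  obtain ⟨φ, hφ, hφG⟩ := exists_monotoneOn_of_blocks (U := Set.univ) (G := G) (Quotient.mk s)
    (fun x _ y _ hxy => Quotient.sound (Linked.of_le hxy)) fun i => by
      induction i using Quotient.inductionOn with
      | h p =>
        obtain ⟨φ, hφ, hφG⟩ := h p
        have hmem : ∀ x, Quotient.mk s x = Quotient.mk s p → Linked p x := fun x hx =>
          Linked.symm (Quotient.exact hx)
        exact ⟨φ, hφ.mono fun x hx => hmem x hx.2, fun x _ hx => hφG x (hmem x hx)⟩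
  exact ⟨φ, monotoneOn_univ.1 hφ, fun x => hφG x trivial⟩

/-- The dichotomy for a pair of components is symmetric under exchanging the posets and negating
`F`, so either poset may be the one made of chains. If one component of `P` admits no `φ`, every
component of `Q` maps into it. -/
theorem exists_monotone_or_of_isDisjointUnionOfChains [Finite P] [Finite Q]
    (h : IsDisjointUnionOfChains P ∨ IsDisjointUnionOfChains Q) (F : P → Q → Prop) :
    (∃ φ : P → Q, Monotone φ ∧ ∀ x, F x (φ x)) ∨
    ∃ (p : P) (ψ : Q → P), Monotone ψ ∧ ∀ y, Linked p (ψ y) ∧ ¬ F (ψ y) y := by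
  have hcomp : ∀ (p : P) (q : Q),
      (∃ φ : P → Q, MonotoneOn φ {x | Linked p x} ∧
        ∀ x, Linked p x → Linked q (φ x) ∧ F x (φ x)) ∨
      ∃ ψ : Q → P, MonotoneOn ψ {y | Linked q y} ∧
        ∀ y, Linked q y → Linked p (ψ y) ∧ ¬ F (ψ y) y := by
    intro p q
    rcases h with h | h
    · exact h.exists_monotoneOn_component_or F p q
    · rcases h.exists_monotoneOn_component_or (fun y x => ¬ F x y) q p with h' | ⟨φ, hφ, hφF⟩
      · exact Or.inr h'
      · exact Or.inl ⟨φ, hφ, fun x hx => ⟨(hφF x hx).1, not_not.1 (hφF x hx).2⟩⟩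
  by_cases hF : ∀ p, ∃ φ : P → Q, MonotoneOn φ {x | Linked p x} ∧ ∀ x, Linked p x → F x (φ x)
  · exact Or.inl (exists_monotone_of_components hF)
  · push Not at hF
    obtain ⟨p, hno⟩ := hF
    refine Or.inr ⟨p, exists_monotone_of_components (G := fun y x => Linked p x ∧ ¬ F x y)
      fun q => ?_⟩
    rcases hcomp p q with ⟨φ, hφ, hφF⟩ | hψ
    · obtain ⟨x, hx, hxF⟩ := hno φ hφ
      exact absurd (hφF x hx).2 hxF
    · exact hψ

end Components

/-! ### Fixed points of isotone self-maps -/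

section FixedPoints

variable {P Q : Type*} [PartialOrder P] [PartialOrder Q]

/-- For a maximal `y` with `y ≤ f y`, the element `f y` satisfies the same inequality. -/
theorem exists_eq_of_monotone_of_le [Finite P] {f : P → P} (hf : Monotone f) {x : P}
    (hx : x ≤ f x) : ∃ y, f y = y := by
  obtain ⟨y, -, hy⟩ := exists_maximal_ge_of_wellFoundedGT (fun y => y ≤ f y) x hx
  exact ⟨y, (hy.eq_of_le (hf hy.prop) hy.prop).symm⟩

theorem exists_eq_of_monotone_of_ge [Finite P] {f : P → P} (hf : Monotone f) {x : P}
    (hx : f x ≤ x) : ∃ y, f y = y :=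
  let ⟨y, hy⟩ := exists_eq_of_monotone_of_le hf.dual (x := OrderDual.toDual x) hx
  ⟨OrderDual.ofDual y, hy⟩

/-- The component of a minimal element of a rooted poset is its principal upper set. Hence a
self-map with image in that component moves the element upwards. -/
theorem IsRooted.le_iff_le_of_linked (hP : IsRooted P) {m a b : P} (hm : IsMin m)
    (h : Linked a b) : m ≤ a ↔ m ≤ b := by
  induction h with
  | rel a b h =>
    refine ⟨fun hma => hma.trans h, fun hmb => ?_⟩
    exact (hP.le_or_le hmb h).elim id fun ham => hm ham
  | refl a => exact Iff.rfl
  | symm a b _ ih => exact ih.symm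
  | trans a b c _ _ ih ih' => exact ih.trans ih'

theorem IsRooted.exists_eq_of_linked [Finite P] (hP : IsRooted P) {f : P → P} (hf : Monotone f)
    {p : P} (hp : ∀ x, Linked p (f x)) : ∃ y, f y = y := by
  obtain ⟨m, hmp, hm⟩ := exists_minimal_le_of_wellFoundedLT (fun _ : P => True) p trivial
  have hmin : IsMin m := fun b hb => hm.le_of_le trivial hb
  exact exists_eq_of_monotone_of_le hf ((hP.le_iff_le_of_linked hmin (hp m)).1 hmp)

theorem Linked.dual {a b : P} (h : Linked a b) :
    Linked (OrderDual.toDual a) (OrderDual.toDual b) := by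
  induction h with
  | rel a b h => exact (Linked.of_le (OrderDual.toDual_le_toDual.2 h) : Linked (OrderDual.toDual b) _).symm
  | refl a => exact linked_equivalence.refl _
  | symm a b _ ih => exact ih.symm
  | trans a b c _ _ ih ih' => exact ih.trans ih'

theorem IsCorooted.exists_eq_of_linked [Finite P] (hP : IsCorooted P) {f : P → P}
    (hf : Monotone f) {p : P} (hp : ∀ x, Linked p (f x)) : ∃ y, f y = y :=
  hP.dual.exists_eq_of_linked hf.dual fun x => (hp x).dual

theorem IsDisjointUnionOfChains.exists_eq_of_linked [Finite P] (hP : IsDisjointUnionOfChains P)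
    {f : P → P} (hf : Monotone f) {p : P} (hp : Linked p (f p)) : ∃ y, f y = y :=
  (hP.le_or_le hp).elim (exists_eq_of_monotone_of_le hf) (exists_eq_of_monotone_of_ge hf)

/-- The condition on pairs of posets that characterizes unmixedness: both are rooted, or both are
co-rooted, or one of them is a disjoint union of chains. -/
def IsCompatiblePair (P Q : Type*) [PartialOrder P] [PartialOrder Q] : Prop :=
  (IsRooted P ∧ IsRooted Q) ∨ (IsCorooted P ∧ IsCorooted Q) ∨
    (IsDisjointUnionOfChains P ∨ IsDisjointUnionOfChains Q)

theorem IsCompatiblePair.exists_monotone_or [Finite P] [Finite Q] (h : IsCompatiblePair P Q)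
    (F : P → Q → Prop) :
    (∃ φ : P → Q, Monotone φ ∧ ∀ x, F x (φ x)) ∨
    ∃ (p : P) (ψ : Q → P), Monotone ψ ∧ ∀ y, Linked p (ψ y) ∧ ¬ F (ψ y) y := by
  rcases h with ⟨hP, hQ⟩ | ⟨hP, hQ⟩ | h
  · refine (hP.exists_monotone_or hQ F).imp_right ?_
    rintro ⟨p, ψ, hψ, hψF⟩
    exact ⟨p, ψ, hψ, fun y => ⟨Linked.of_le (hψF y).1, (hψF y).2⟩⟩
  · refine (hP.exists_monotone_or hQ F).imp_right ?_
    rintro ⟨p, ψ, hψ, hψF⟩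
    exact ⟨p, ψ, hψ, fun y => ⟨(Linked.of_le (hψF y).1).symm, (hψF y).2⟩⟩
  · exact exists_monotone_or_of_isDisjointUnionOfChains h F

theorem IsCompatiblePair.exists_apply_apply_eq [Finite P] [Finite Q] (h : IsCompatiblePair P Q)
    {φ : P → Q} (hφ : Monotone φ) {ψ : Q → P} (hψ : Monotone ψ) {p : P}
    (hp : ∀ y, Linked p (ψ y)) : ∃ x, ψ (φ x) = x := by
  have hmono : Monotone fun x => ψ (φ x) := fun a b hab => hψ (hφ hab)
  rcases h with ⟨hP, -⟩ | ⟨hP, -⟩ | hP | hQ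
  · exact hP.exists_eq_of_linked hmono fun x => hp (φ x)
  · exact hP.exists_eq_of_linked hmono fun x => hp (φ x)
  · exact hP.exists_eq_of_linked hmono (hp (φ p))
  -- Chains in `Q` give a fixed point of `φ ∘ ψ`, which `ψ` carries to one of `ψ ∘ φ`.
  · obtain ⟨y, hy⟩ := hQ.exists_eq_of_linked (f := fun y => φ (ψ y))
      (fun a b hab => hφ (hψ hab)) ((hp (φ p)).map hφ)
    exact ⟨ψ y, congrArg ψ hy⟩

end FixedPoints

/-! ### Transposed graphs -/

section TransposedGraph

variable {P Q : Type*}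

/-- The transposed graph of a map `Q → P`. -/
def transposedGraph [Fintype Q] (ψ : Q → P) : Finset (P × Q) :=
  Finset.univ.map ⟨fun y => (ψ y, y), fun _ _ h => congrArg Prod.snd h⟩

theorem mem_transposedGraph [Fintype Q] {ψ : Q → P} {x : P} {y : Q} :
    (x, y) ∈ transposedGraph ψ ↔ ψ y = x := by
  refine Finset.mem_map.trans ⟨?_, ?_⟩
  · rintro ⟨z, -, hz⟩
    obtain ⟨rfl, rfl⟩ := Prod.mk.inj hz
    rfl
  · rintro rfl
    exact ⟨y, Finset.mem_univ y, rfl⟩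

theorem card_transposedGraph [Fintype Q] (ψ : Q → P) :
    (transposedGraph ψ).card = Fintype.card Q := by
  simp [transposedGraph]

end TransposedGraph

/-! ### Sizes of minimal covers -/

section Covers

variable {P Q : Type*} [PartialOrder P] [PartialOrder Q]

/-- `C` is a cover if it meets the graph of every isotone map `P → Q`. -/
def IsCover (C : Finset (P × Q)) : Prop :=
  ∀ φ : P → Q, Monotone φ → ∃ x, (x, φ x) ∈ C

theorem IsCover.image_snd_eq_univ [Fintype Q] [DecidableEq Q] {C : Finset (P × Q)}
    (hC : IsCover C) : C.image Prod.snd = Finset.univ := by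
  refine Finset.eq_univ_of_forall fun y => ?_
  obtain ⟨x, hx⟩ := hC (fun _ => y) monotone_const
  exact Finset.mem_image_of_mem Prod.snd hx

theorem IsCover.card_le [Fintype Q] {C : Finset (P × Q)} (hC : IsCover C) :
    Fintype.card Q ≤ C.card := by
  classical
  rw [← Finset.card_univ, ← hC.image_snd_eq_univ]
  exact Finset.card_image_le

theorem minimal_isCover_of_card_eq [Fintype Q] {C : Finset (P × Q)}
    (hC : IsCover C) (hcard : C.card = Fintype.card Q) : Minimal IsCover C :=
  ⟨hC, fun _ hD hDC => (Finset.eq_of_subset_of_card_le hDC (hcard ▸ hD.card_le)).ge⟩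

theorem exists_minimal_isCover_card_eq [Fintype Q] (p : P) :
    ∃ C : Finset (P × Q), Minimal IsCover C ∧ C.card = Fintype.card Q := by
  have hcard : (({p} : Finset P) ×ˢ (Finset.univ : Finset Q)).card = Fintype.card Q := by simp
  exact ⟨_, minimal_isCover_of_card_eq (fun φ _ => ⟨p, by simp⟩) hcard, hcard⟩

theorem IsCompatiblePair.isCover_transposedGraph [Finite P] [Fintype Q]
    (h : IsCompatiblePair P Q) {ψ : Q → P} (hψ : Monotone ψ) {p : P}
    (hp : ∀ y, Linked p (ψ y)) : IsCover (transposedGraph ψ) := by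
  intro φ hφ
  obtain ⟨x, hx⟩ := h.exists_apply_apply_eq hφ hψ hp
  exact ⟨x, mem_transposedGraph.2 hx⟩

theorem IsCompatiblePair.exists_transposedGraph_subset [Finite P] [Fintype Q]
    (h : IsCompatiblePair P Q) {C : Finset (P × Q)} (hC : IsCover C) :
    ∃ (p : P) (ψ : Q → P), Monotone ψ ∧ (∀ y, Linked p (ψ y)) ∧ transposedGraph ψ ⊆ C := by
  rcases h.exists_monotone_or fun x y => (x, y) ∉ C with ⟨φ, hφ, hφC⟩ | ⟨p, ψ, hψ, hψC⟩
  · obtain ⟨x, hx⟩ := hC φ hφ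
    exact absurd hx (hφC x)
  · refine ⟨p, ψ, hψ, fun y => (hψC y).1, ?_⟩
    rintro ⟨x, y⟩ hxy
    obtain rfl := mem_transposedGraph.1 hxy
    exact not_not.1 (hψC y).2

theorem IsCompatiblePair.card_eq_of_minimal_isCover [Finite P] [Fintype Q]
    (h : IsCompatiblePair P Q) {C : Finset (P × Q)} (hC : Minimal IsCover C) :
    C.card = Fintype.card Q := by
  obtain ⟨p, ψ, hψ, hp, hsub⟩ := h.exists_transposedGraph_subset hC.prop
  rw [← hC.eq_of_le (h.isCover_transposedGraph hψ hp) hsub, card_transposedGraph]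

theorem exists_minimal_isCover_card_lt_of_not_isRooted [Finite P] [Fintype Q] (hP : ¬ IsRooted P)
    (hQ : ¬ IsCorooted Q) :
    ∃ C : Finset (P × Q), Minimal IsCover C ∧ Fintype.card Q < C.card := by
  classical
  have := Fintype.ofFinite P
  simp only [IsRooted, IsCorooted, not_forall, not_not] at hP hQ
  obtain ⟨p₁, p₂, hp, p, hp₁, hp₂⟩ := hP
  obtain ⟨q₁, q₂, hq, q, hq₁, hq₂⟩ := hQ
  -- An isotone map avoiding the first two pieces sends `p₁` above `q₁` and `p₂` above `q₂`, hence
  -- `p` above both, and so meets the third.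
  let C : Finset (P × Q) := {z | (z.1 = p₁ ∧ ¬ q₁ ≤ z.2) ∨ (z.1 = p₂ ∧ ¬ q₂ ≤ z.2) ∨
    (z.1 = p ∧ q₁ ≤ z.2 ∧ q₂ ≤ z.2)}
  have hmem : ∀ x y, (x, y) ∈ C ↔ (x = p₁ ∧ ¬ q₁ ≤ y) ∨ (x = p₂ ∧ ¬ q₂ ≤ y) ∨
      (x = p ∧ q₁ ≤ y ∧ q₂ ≤ y) := by simp [C]
  have hC : IsCover C := by
    intro φ hφ
    by_cases h₁ : q₁ ≤ φ p₁
    · by_cases h₂ : q₂ ≤ φ p₂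
      · exact ⟨p, (hmem _ _).2 (Or.inr (Or.inr ⟨rfl, h₁.trans (hφ hp₁.le), h₂.trans (hφ hp₂.le)⟩))⟩
      · exact ⟨p₂, (hmem _ _).2 (Or.inr (Or.inl ⟨rfl, h₂⟩))⟩
    · exact ⟨p₁, (hmem _ _).2 (Or.inl ⟨rfl, h₁⟩)⟩
  obtain ⟨D, hDC, hD⟩ := exists_minimal_le_of_wellFoundedLT IsCover C hC
  -- The step map at `p₂` with values `q` and `q₂` meets `C` only in `(p₁, q)`, and symmetrically.
  -- So `D` contains two points of the fibre over `q`.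
  have hstep : ∀ (a : P) (b : Q), q ≤ b → Monotone fun x => if a ≤ x then b else q := by
    intro a b hb x y hxy
    by_cases hx : a ≤ x
    · simp [hx, hx.trans hxy]
    · by_cases hy : a ≤ y <;> simp [hx, hy, hb]
  have hD₁ : (p₁, q) ∈ D := by
    obtain ⟨x, hx⟩ := hD.prop _ (hstep p₂ q₂ hq₂.le)
    rcases (hmem _ _).1 (hDC hx) with ⟨rfl, -⟩ | ⟨rfl, h⟩ | ⟨rfl, h, -⟩
    · simpa [hp.2] using hx
    · simp at h
    · rw [if_pos hp₂.le] at h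
      exact absurd h hq.1
  have hD₂ : (p₂, q) ∈ D := by
    obtain ⟨x, hx⟩ := hD.prop _ (hstep p₁ q₁ hq₁.le)
    rcases (hmem _ _).1 (hDC hx) with ⟨rfl, h⟩ | ⟨rfl, -⟩ | ⟨rfl, -, h⟩
    · simp at h
    · simpa [hp.1] using hx
    · rw [if_pos hp₁.le] at h
      exact absurd h hq.2
  refine ⟨D, hD, lt_of_le_of_ne hD.prop.card_le fun hcard => ?_⟩
  rw [← Finset.card_univ, ← hD.prop.image_snd_eq_univ] at hcard
  have := Finset.card_image_iff.1 hcard hD₁ hD₂ rfl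
  exact hp.1 (Prod.mk.inj this).1.le

theorem IsCover.dual {C : Finset (P × Q)} (hC : IsCover C) :
    IsCover (P := Pᵒᵈ) (Q := Qᵒᵈ) C :=
  fun φ hφ => hC (fun x => OrderDual.ofDual (φ (OrderDual.toDual x))) fun _ _ h => hφ h

theorem not_isRooted_dual (hP : ¬ IsCorooted P) : ¬ IsRooted Pᵒᵈ := fun h =>
  hP fun a b hab ⟨c, hca, hcb⟩ => h (OrderDual.toDual a) (OrderDual.toDual b) hab.symm
    ⟨OrderDual.toDual c, hca, hcb⟩

theorem not_isCorooted_dual (hP : ¬ IsRooted P) : ¬ IsCorooted Pᵒᵈ := fun h =>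
  hP fun a b hab ⟨c, hca, hcb⟩ => h (OrderDual.toDual a) (OrderDual.toDual b) hab.symm
    ⟨OrderDual.toDual c, hca, hcb⟩

/-- Reversing both orders preserves isotone maps, hence covers. -/
theorem exists_minimal_isCover_card_lt_of_not_isCorooted [Finite P] [Fintype Q] (hP : ¬ IsCorooted P)
    (hQ : ¬ IsRooted Q) :
    ∃ C : Finset (P × Q), Minimal IsCover C ∧ Fintype.card Q < C.card := by
  obtain ⟨C, hC, hcard⟩ := exists_minimal_isCover_card_lt_of_not_isRooted (P := Pᵒᵈ) (Q := Qᵒᵈ)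
    (not_isRooted_dual hP) (not_isCorooted_dual hQ)
  exact ⟨C, ⟨IsCover.dual (P := Pᵒᵈ) (Q := Qᵒᵈ) hC.prop,
    fun D hD hDC => hC.le_of_le hD.dual hDC⟩, hcard⟩

theorem isCompatiblePair_of_forall_card_eq [Finite P] [Fintype Q]
    (h : ∀ C D : Finset (P × Q), Minimal IsCover C → Minimal IsCover D → C.card = D.card) :
    IsCompatiblePair P Q := by
  have hno : ∀ C : Finset (P × Q), Minimal IsCover C → ¬ Fintype.card Q < C.card := by
    intro C hC hlt
    -- A cover with more than `|Q|` points is non-empty, which supplies the `p` for the comparison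
    -- cover `{p} × Q`.
    obtain ⟨z, -⟩ := Finset.card_pos.1 ((Nat.zero_le _).trans_lt hlt)
    obtain ⟨D, hD, hcard⟩ := exists_minimal_isCover_card_eq (Q := Q) z.1
    exact hlt.ne ((h C D hC hD).trans hcard).symm
  have h₁ : IsRooted P ∨ IsCorooted Q := by
    by_contra! hPQ
    obtain ⟨C, hC, hcard⟩ := exists_minimal_isCover_card_lt_of_not_isRooted hPQ.1 hPQ.2
    exact hno C hC hcard
  have h₂ : IsCorooted P ∨ IsRooted Q := by
    by_contra! hPQ
    obtain ⟨C, hC, hcard⟩ := exists_minimal_isCover_card_lt_of_not_isCorooted hPQ.1 hPQ.2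
    exact hno C hC hcard
  rcases h₁ with hP | hQ <;> rcases h₂ with hP' | hQ'
  · exact Or.inr (Or.inr (Or.inl (isDisjointUnionOfChains_of_isRooted_of_isCorooted hP hP')))
  · exact Or.inl ⟨hP, hQ'⟩
  · exact Or.inr (Or.inl ⟨hP', hQ⟩)
  · exact Or.inr (Or.inr (Or.inr (isDisjointUnionOfChains_of_isRooted_of_isCorooted hQ' hQ)))

end Covers

/-! ### Translation back to ideals -/

section Main

variable (K : Type*) [Field K] {P Q : Type*} [PartialOrder P] [PartialOrder Q]

theorem switchIndices_L [Fintype Q] : switchIndices (L K Q P) =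
    Ideal.span (Set.range fun ψ : Q →o P => squarefreeMonomial K (transposedGraph ψ)) := by
  rw [switchIndices, L, Ideal.map_span, ← Set.range_comp]
  simp [Function.comp_def, squarefreeMonomial, transposedGraph, map_prod]
  rfl

variable [Fintype P]

/-- The graph of an isotone map. -/
def graph (φ : P →o Q) : Finset (P × Q) :=
  Finset.univ.map ⟨fun x => (x, φ x), fun _ _ h => congrArg Prod.fst h⟩

theorem L_eq_edgeIdeal : L K P Q = edgeIdeal K (graph (P := P) (Q := Q)) := by
  simp only [L, edgeIdeal, squarefreeMonomial, graph, Finset.prod_map]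
  rfl

theorem isTransversal_graph_iff {C : Finset (P × Q)} :
    IsTransversal (graph (P := P) (Q := Q)) C ↔ IsCover C := by
  constructor
  · intro h φ hφ
    obtain ⟨v, hv, hvC⟩ := h ⟨φ, hφ⟩
    obtain ⟨x, -, rfl⟩ := Finset.mem_map.1 hv
    exact ⟨x, hvC⟩
  · intro h φ
    obtain ⟨x, hx⟩ := h φ φ.monotone
    exact ⟨_, Finset.mem_map_of_mem _ (Finset.mem_univ x), hx⟩

theorem isTransversal_graph : IsTransversal (graph (P := P) (Q := Q)) = IsCover :=
  funext fun _ => propext isTransversal_graph_iff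

theorem isUnmixed_L_iff [Fintype Q] : IsUnmixed (L K P Q) ↔ IsCompatiblePair P Q := by
  rw [L_eq_edgeIdeal, isUnmixed_edgeIdeal_iff, isTransversal_graph]
  refine ⟨isCompatiblePair_of_forall_card_eq, fun h C D hC hD => ?_⟩
  rw [h.card_eq_of_minimal_isCover hC, h.card_eq_of_minimal_isCover hD]

theorem alexanderDual_L [Fintype Q] [DecidableEq P] [DecidableEq Q] (h : IsCompatiblePair P Q)
    (hconn : IsConnected P ∨ IsConnected Q) :
    alexanderDual (L K P Q) = switchIndices (L K Q P) := by
  rw [L_eq_edgeIdeal, alexanderDual_edgeIdeal, isTransversal_graph, switchIndices_L]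
  apply le_antisymm <;> rw [Ideal.span_le]
  · rintro _ ⟨C, hC, rfl⟩
    obtain ⟨p, ψ, hψ, -, hsub⟩ := h.exists_transposedGraph_subset hC
    exact Ideal.mem_of_dvd _ (Finset.prod_dvd_prod_of_subset _ _ _ hsub)
      (Ideal.subset_span ⟨⟨ψ, hψ⟩, rfl⟩)
  · rintro _ ⟨ψ, rfl⟩
    refine Ideal.subset_span ⟨_, fun φ hφ => ?_, rfl⟩
    -- The only use of connectedness: without it, `ψ` could spread over several components and its
    -- transposed graph might miss some graph.
    obtain ⟨p, hp⟩ : ∃ p, ∀ y, Linked p (ψ y) := by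
      rcases hconn with hP | hQ
      · obtain ⟨p⟩ := SimpleGraph.Connected.nonempty hP
        exact ⟨p, fun y => hP.linked p (ψ y)⟩
      · obtain ⟨q⟩ := SimpleGraph.Connected.nonempty hQ
        exact ⟨ψ q, fun y => (hQ.linked q y).map ψ.monotone⟩
    exact h.isCover_transposedGraph ψ.monotone hp φ hφ

end Main

end PosetHomIdeal

theorem mainTheorem8 (K : Type*) [Field K]
    (P : Type*) [PartialOrder P] [Fintype P] [DecidableEq P]
    (Q : Type*) [PartialOrder Q] [Fintype Q] [DecidableEq Q] :
    (PosetHomIdeal.IsUnmixed (PosetHomIdeal.L K P Q) ↔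
      (PosetHomIdeal.IsRooted P ∧ PosetHomIdeal.IsRooted Q) ∨
      (PosetHomIdeal.IsCorooted P ∧ PosetHomIdeal.IsCorooted Q) ∨
      (PosetHomIdeal.IsDisjointUnionOfChains P ∨ PosetHomIdeal.IsDisjointUnionOfChains Q)) ∧
    ((PosetHomIdeal.IsConnected P ∨ PosetHomIdeal.IsConnected Q) →
      PosetHomIdeal.IsUnmixed (PosetHomIdeal.L K P Q) →
      PosetHomIdeal.alexanderDual (PosetHomIdeal.L K P Q) =
        PosetHomIdeal.switchIndices (PosetHomIdeal.L K Q P)) :=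
  ⟨PosetHomIdeal.isUnmixed_L_iff K, fun hconn h =>
    PosetHomIdeal.alexanderDual_L K ((PosetHomIdeal.isUnmixed_L_iff K).1 h) hconn⟩
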